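/- Let $n$ source arms have distributions $S_1,\dots,S_n$ on $\mathbb R$ with means $\mu_i$, each $\sigma$-sub-Gaussian for a known $\sigma>0$: $\mathbb E_{X\sim S_i}\, e^{\lambda(X-\mu_i)}\le e^{\lambda^2\sigma^2/2}$ for all $\lambda\in\mathbb R$. Let $A\in\mathbb R^{m\times n}$ with $m\ge 2$, let the target means be $\nu=A\mu$, let $\nu_{(1)}\ge\nu_{(2)}$ be the two largest entries of $\nu$ (with multiplicity), $\bar\nu=(\nu_{(1)}+\nu_{(2)})/2$, and let $s_a$ be the number of nonzero entries of row $a$ of $A$. Let $\varepsilon\ge 0$ and $\delta\in(0,1)$; if $\varepsilon=0$, assume $\nu_{(1)}>\nu_{(2)}$. Put $$H_\varepsilon=\sum_{i=1}^n\max_{1\le a\le m}\frac{s_a^2|A_{a,i}|^2}{\max\{|\bar\nu-\nu_a|,\varepsilon/2\}^2}.$$ T-LUCB with input $(\varepsilon,\delta,A,\sigma)$ is the following algorithm. Observations are independent, and those of source arm $i$ are distributed as $S_i$. First sample each source arm once. At the start of round $t=1,2,\dots$ let $N_i(t)$ be the number of observations of source arm $i$ so far and $\hat\mu_i(t)$ their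 mean, and let $$U_i(t)=\min_{1\le r\le t}\big(\hat\mu_i(r)+\beta(N_i(r),\tfrac{\delta}{2n})\big),\qquad L_i(t)=\max_{1\le r\le t}\big(\hat\mu_i(r)-\beta(N_i(r),\tfrac{\delta}{2n})\big),$$ $$\beta(k,\alpha)=1.7\sqrt{\frac{\sigma^2\big(\log\log(2k\max\{\sigma^2,1\})+0.72\log(5.2/\alpha)\big)}{k}}.$$ For a target arm $a$ let $\mathrm{LCB}_a(t)=\sum_i\min_{v\in[L_i(t),U_i(t)]}A_{a,i}v$ and $\mathrm{UCB}_a(t)=\sum_i\max_{v\in[L_i(t),U_i(t)]}A_{a,i}v$. Choose $B_t$ maximizing $\mathrm{LCB}_a(t)$ over all $a$, and $C_t$ maximizing $\mathrm{UCB}_a(t)$ over $a\ne B_t$. If $\mathrm{LCB}_{B_t}(t)+\varepsilon\ge\mathrm{UCB}_{C_t}(t)$, stop and return $B_t$. Otherwise choose $I_t$, respectively $J_t$, maximizing over $i$ the difference $\max_{v\in[L_i(t),U_i(t)]}A_{a,i}v-\min_{v\in[L_i(t),U_i(t)]}A_{a,i}v$ with $a=B_t$, respectively $a=C_t$, and observe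 one new sample of source arm $I_t$ and one of source arm $J_t$. Ties are broken arbitrarily. The stopping time $\tau$ is the number of the round in which the algorithm stops ($\infty$ if it never stops). Then there is a universal constant $K>0$ such that, in every such setting, with probability at least $1-\delta$ the algorithm stops and $$\tau\le 1+K\sigma^2H_\varepsilon\Big(\log\frac{2n}{\delta}+\log\log\big(e+\max\{\sigma^2,1\}\,\sigma^2H_\varepsilon\big)\Big).$$ In this bound, $\tau\le\tilde O(H_\varepsilon\log(1/\delta))$ is made explicit: the confidence level $\delta/(2n)$ of the individual bounds, the factor $\sigma^2$ and the $\log\log$ term are written out. -/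

import Mathlib

open MeasureTheory ProbabilityTheory
open scoped Matrix

noncomputable section

namespace TLUCB

variable {n m : ℕ}

/-- The polynomial stitched boundary `β(k, α)`: the half-width, at level `α`, of the confidence
interval built from `k` observations that are `σ`-sub-Gaussian. The `max` keeps the iterated
logarithm in its domain when `σ < 1`; for `1 ≤ σ` it is just `log log (2kσ²)`. -/
def stitchedRadius (σ : ℝ) (k : ℕ) (α : ℝ) : ℝ :=
  1.7 * √(σ ^ 2 * (Real.log (Real.log (2 * k * max (σ ^ 2) 1)) + 0.72 * Real.log (5.2 / α)) / k)

/-! Rounds are indexed from `0`: index `t` below is round `t + 1` of the algorithm.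
`x i k` is the outcome of the `(k+1)`-st pull of source arm `i`, and `I t`, `J t` are the two
source arms that are pulled in the round with index `t`. -/

/-- Number of pulls of source arm `i` before the round with index `t`: the initial one, and those
made in the rounds with index `< t` (two in one round if `I s = J s = i`). -/
def pulls (I J : ℕ → Fin n) (i : Fin n) (t : ℕ) : ℕ :=
  1 + ∑ s ∈ Finset.range t, ((if I s = i then 1 else 0) + (if J s = i then 1 else 0))

/-- Mean of the observations of source arm `i` made before the round with index `t`. -/
def empMean (x : Fin n → ℕ → ℝ) (I J : ℕ → Fin n) (i : Fin n) (t : ℕ) : ℝ :=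
  (∑ k ∈ Finset.range (pulls I J i t), x i k) / pulls I J i t

/-- Half-width of the interval around the empirical mean: the stitched boundary at level
`δ / (2n)`. -/
def radius (σ δ : ℝ) (I J : ℕ → Fin n) (i : Fin n) (t : ℕ) : ℝ :=
  stitchedRadius σ (pulls I J i t) (δ / (2 * n))

/-- Upper confidence bound of source arm `i`, with running minimum (the bound before the first
round is `+∞`). -/
def srcUCB (σ δ : ℝ) (x : Fin n → ℕ → ℝ) (I J : ℕ → Fin n) (i : Fin n) : ℕ → ℝ
  | 0 => empMean x I J i 0 + radius σ δ I J i 0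
  | t + 1 => min (srcUCB σ δ x I J i t) (empMean x I J i (t + 1) + radius σ δ I J i (t + 1))

/-- Lower confidence bound of source arm `i`, with running maximum (the bound before the first
round is `-∞`). -/
def srcLCB (σ δ : ℝ) (x : Fin n → ℕ → ℝ) (I J : ℕ → Fin n) (i : Fin n) : ℕ → ℝ
  | 0 => empMean x I J i 0 - radius σ δ I J i 0
  | t + 1 => max (srcLCB σ δ x I J i t) (empMean x I J i (t + 1) - radius σ δ I J i (t + 1))

/-- Confidence interval of source arm `i`. -/
def srcCI (σ δ : ℝ) (x : Fin n → ℕ → ℝ) (I J : ℕ → Fin n) (i : Fin n) (t : ℕ) : Set ℝ :=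
  Set.Icc (srcLCB σ δ x I J i t) (srcUCB σ δ x I J i t)

/-- Minimum of `v ↦ A a i * v` over the confidence interval of source arm `i`. -/
def termMin (A : Matrix (Fin m) (Fin n) ℝ) (σ δ : ℝ) (x : Fin n → ℕ → ℝ) (I J : ℕ → Fin n)
    (a : Fin m) (i : Fin n) (t : ℕ) : ℝ :=
  sInf ((fun v => A a i * v) '' srcCI σ δ x I J i t)

/-- Maximum of `v ↦ A a i * v` over the confidence interval of source arm `i`. -/
def termMax (A : Matrix (Fin m) (Fin n) ℝ) (σ δ : ℝ) (x : Fin n → ℕ → ℝ) (I J : ℕ → Fin n)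
    (a : Fin m) (i : Fin n) (t : ℕ) : ℝ :=
  sSup ((fun v => A a i * v) '' srcCI σ δ x I J i t)

/-- Lower confidence bound of target arm `a`. -/
def tgtLCB (A : Matrix (Fin m) (Fin n) ℝ) (σ δ : ℝ) (x : Fin n → ℕ → ℝ) (I J : ℕ → Fin n)
    (a : Fin m) (t : ℕ) : ℝ :=
  ∑ i, termMin A σ δ x I J a i t

/-- Upper confidence bound of target arm `a`. -/
def tgtUCB (A : Matrix (Fin m) (Fin n) ℝ) (σ δ : ℝ) (x : Fin n → ℕ → ℝ) (I J : ℕ → Fin n)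
    (a : Fin m) (t : ℕ) : ℝ :=
  ∑ i, termMax A σ δ x I J a i t

/-- Contribution of source arm `i` to the length of the confidence interval of target arm `a`. -/
def uncertainty (A : Matrix (Fin m) (Fin n) ℝ) (σ δ : ℝ) (x : Fin n → ℕ → ℝ) (I J : ℕ → Fin n)
    (i : Fin n) (a : Fin m) (t : ℕ) : ℝ :=
  termMax A σ δ x I J a i t - termMin A σ δ x I J a i t

/-- `B, C, I, J` are the choices made by T-LUCB with linear transfer function `A`, input `σ`, `δ`
and outcomes `x`. Each choice is a maximizer, ties being broken arbitrarily. For convenience the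
rule is continued after the algorithm has stopped; this does not affect the stopping time. -/
structure IsRun (A : Matrix (Fin m) (Fin n) ℝ) (σ δ : ℝ) (x : Fin n → ℕ → ℝ)
    (B C : ℕ → Fin m) (I J : ℕ → Fin n) : Prop where
  B_max : ∀ t a, tgtLCB A σ δ x I J a t ≤ tgtLCB A σ δ x I J (B t) t
  C_ne : ∀ t, C t ≠ B t
  C_max : ∀ t a, a ≠ B t → tgtUCB A σ δ x I J a t ≤ tgtUCB A σ δ x I J (C t) t
  I_max : ∀ t i, uncertainty A σ δ x I J i (B t) t ≤ uncertainty A σ δ x I J (I t) (B t) t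
  J_max : ∀ t i, uncertainty A σ δ x I J i (C t) t ≤ uncertainty A σ δ x I J (J t) (C t) t

/-- The stopping rule in the round with index `t`. -/
def Stops (A : Matrix (Fin m) (Fin n) ℝ) (σ δ ε : ℝ) (x : Fin n → ℕ → ℝ)
    (B C : ℕ → Fin m) (I J : ℕ → Fin n) (t : ℕ) : Prop :=
  tgtUCB A σ δ x I J (C t) t ≤ tgtLCB A σ δ x I J (B t) t + ε

/-- The stopping time: the number of the first round (counted from `1`) in which the stopping rule
is met, and `⊤` if there is none. -/
def stoppingTime (A : Matrix (Fin m) (Fin n) ℝ) (σ δ ε : ℝ) (x : Fin n → ℕ → ℝ)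
    (B C : ℕ → Fin m) (I J : ℕ → Fin n) : ℕ∞ :=
  ⨅ (t : ℕ) (_ : Stops A σ δ ε x B C I J t), ((t + 1 : ℕ) : ℕ∞)

/-- The number `s_a` of nonzero entries in row `a`. -/
def sparsity (A : Matrix (Fin m) (Fin n) ℝ) (a : Fin m) : ℕ :=
  {i | A a i ≠ 0}.ncard

/-- The complexity `H_ε = ∑ᵢ maxₐ sₐ² |Aₐᵢ|² / max {|ν̄ - νₐ|, ε/2}²`. -/
def complexity (A : Matrix (Fin m) (Fin n) ℝ) (ν : Fin m → ℝ) (νbar ε : ℝ) : ℝ :=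
  ∑ i, ⨆ a, (sparsity A a : ℝ) ^ 2 * |A a i| ^ 2 / max |νbar - ν a| (ε / 2) ^ 2

end TLUCB

end

/-!
The proof has a probabilistic half and a pathwise half.

**Coverage.** For one arm with centred partial sums `S k` and fixed `l`, `x`, the line-crossing
bound `P (∃ k, l * S k ≥ x + k * σ² * l² / 2) ≤ exp (-x)` is Ville's inequality, obtained here from
Doob's maximal inequality for the martingale `∏ exp (l * Y i) / mgf (Y i) l`. The boundary
`stitchedRadius` comes from stitching such lines: on the dyadic epoch `2 ^ j ≤ k ≤ 2 ^ (j + 1)` the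
line is tuned to the geometric midpoint `√2 * 2 ^ j` and gets the share
`α / 3.14 * (j + 1) ^ (-1.4)` of the error probability. The constants `1.7`, `0.72`, `5.2` of the boundary are nearly
sharp for this argument. It needs `∑ j ^ (-1.4) ≤ 3.14` (`sum_rpow_le`; the sum is about `3.106`),
`log 3.14 ≤ 1.4 * (log (log 2) + 0.72 * log 5.2)` (inside `stitching_exponent_le`; the two sides
differ by less than `0.005`), and `1.4 * (1 + (√2 + 1 / √2) / 2) ≤ 1.7 ^ 2` (inside
`line_le_boundary`). A union bound over the arms and the two tails
(`measure_confidence_failure_le`) shows that, outside an event of probability at most `δ`, all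
confidence intervals contain the source means (`IsCovered`).

**Stopping.** On `IsCovered` the rest is deterministic. In a round without a stop, the interval of
`B t` or of `C t` is at least as long as the gap `max |ν̄ - ν a| (ε / 2)` of that arm
(`exists_gap_le_width`), so the source arm pulled for it contributes at least a fraction
`1 / sparsity A a`. Since its contribution is at most `2 * |A a i| * radius`, its number of pulls obeys
`N ≤ 11.56 * σ² * h i * (log log (2 * N * max σ² 1) + ...)`, where `h i` is the `i`-th summand of
the complexity. Inverting this inequality (`le_of_le_mul_log_log`) bounds `N`. Every such round is
charged to one source arm, whose number of pulls then increases, so the bounds on `N`, summed over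
the arms, bound the number of rounds without a stop (`le_sum_of_pulls_le`).
-/

namespace TLUCB

/-! ### Numerical estimates for the stitched boundary -/

/-- The midpoint rule underestimates the integral of the convex function `p * t ^ (-p - 1)` over
`[1 - y, 1 + y]`. -/
theorem two_mul_le_rpow_sub_rpow {p y : ℝ} (hp : 0 ≤ p) (hy : 0 ≤ y) (hy1 : y < 1) :
    2 * p * y ≤ (1 - y) ^ (-p) - (1 + y) ^ (-p) := by
  have hu : 0 ≤ -Real.log (1 - y) - Real.log (1 + y) := by
    rw [← neg_add', ← Real.log_mul (by linarith) (by linarith)]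
    have := Real.log_nonpos (x := (1 - y) * (1 + y)) (by nlinarith) (by nlinarith)
    linarith
  have h1 : 2 * y ≤ Real.log (1 + y) - Real.log (1 - y) := by
    have h := Real.hasSum_log_sub_log_of_abs_lt_one (x := y) (by rw [abs_of_nonneg hy]; exact hy1)
    have := h.summable.le_tsum 0 (fun k _ => by positivity)
    rw [h.tsum_eq] at this
    simpa using this
  rw [Real.rpow_def_of_pos (by linarith), Real.rpow_def_of_pos (by linarith)]
  set a := Real.log (1 - y)
  set b := Real.log (1 + y)
  -- `exp u - exp (-v) = exp ((u - v) / 2) * 2 * sinh ((u + v) / 2)` with `u = -p a`, `v = p b`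
  have e2 : Real.exp (a * -p) - Real.exp (b * -p)
      = Real.exp (p * (-a - b) / 2) * (2 * Real.sinh (p * (b - a) / 2)) := by
    rw [Real.sinh_eq, mul_div_cancel₀ _ (two_ne_zero' ℝ), mul_sub,
      ← Real.exp_add, ← Real.exp_add]
    congr 2 <;> ring
  rw [e2]
  have h3 : p * (b - a) / 2 ≤ Real.sinh (p * (b - a) / 2) :=
    Real.self_le_sinh_iff.2 (by apply div_nonneg (mul_nonneg hp _) <;> linarith)
  have h4 : 1 ≤ Real.exp (p * (-a - b) / 2) :=
    Real.one_le_exp (by apply div_nonneg (mul_nonneg hp _) <;> linarith)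
  have h5 : 0 ≤ p * (b - a) / 2 := by apply div_nonneg (mul_nonneg hp _) <;> linarith
  nlinarith

/-- The midpoint bound `x ^ (-p - 1) ≤ ∫ t in x - 1/2..x + 1/2, t ^ (-p - 1)`; it telescopes over
the integers and loses much less than comparison with the integral over `[x - 1, x]`. -/
theorem rpow_neg_succ_le {p x : ℝ} (hp : 0 < p) (hx : 1 ≤ x) :
    x ^ (-(p + 1)) ≤ p⁻¹ * ((x - 1 / 2) ^ (-p) - (x + 1 / 2) ^ (-p)) := by
  have h := two_mul_le_rpow_sub_rpow hp.le (y := 1 / (2 * x)) (by positivity)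
    (by rw [div_lt_one (by positivity)]; linarith)
  have hx0 : 0 < x := by linarith
  have hy : 1 / (2 * x) ≤ 1 := by rw [div_le_one (by positivity)]; linarith
  have e1 : x - 1 / 2 = x * (1 - 1 / (2 * x)) := by field_simp
  have e2 : x + 1 / 2 = x * (1 + 1 / (2 * x)) := by field_simp
  rw [e1, e2, Real.mul_rpow hx0.le (by linarith), Real.mul_rpow hx0.le (by positivity), ← mul_sub,
    neg_add, Real.rpow_add hx0, Real.rpow_neg_one]
  have h0 : 0 < x ^ (-p) := Real.rpow_pos_of_pos hx0 _
  calc x ^ (-p) * x⁻¹ = p⁻¹ * (x ^ (-p) * (2 * p * (1 / (2 * x)))) := by field_simp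
    _ ≤ _ := by gcongr

/-- The normalizing constant of the stitching weights. The first term is kept and the others are
compared with the integral over `[1.5, ∞)`, which gives `1 + 2.5 * 1.5 ^ (-0.4) < 3.13`. -/
theorem sum_rpow_le (N : ℕ) :
    ∑ j ∈ Finset.range N, ((j : ℝ) + 1) ^ (-(1.4 : ℝ)) ≤ 3.14 := by
  have key : ∀ N : ℕ, ∑ j ∈ Finset.range N, ((j : ℝ) + 2) ^ (-(1.4 : ℝ))
      ≤ 2.5 * ((1.5 : ℝ) ^ (-(0.4 : ℝ)) - ((N : ℝ) + 1.5) ^ (-(0.4 : ℝ))) := by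
    intro N
    induction N with
    | zero => simp
    | succ N ih =>
      rw [Finset.sum_range_succ]
      have h := rpow_neg_succ_le (p := 0.4) (x := (N : ℝ) + 2) (by norm_num)
        (by linarith [N.cast_nonneg (α := ℝ)])
      have e1 : (N : ℝ) + 2 - 1 / 2 = N + 1.5 := by ring
      have e2 : (N : ℝ) + 2 + 1 / 2 = (N + 1 : ℕ) + 1.5 := by push_cast; ring
      rw [e1, e2] at h
      norm_num at h ih ⊢
      linarith
  have h15 : (1.5 : ℝ) ^ (-(0.4 : ℝ)) ≤ 0.856 := by
    rw [Real.rpow_neg (by norm_num), inv_le_comm₀ (by positivity) (by norm_num)]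
    calc (0.856 : ℝ)⁻¹ = (((0.856 : ℝ)⁻¹) ^ (5 : ℕ)) ^ (1 / 5 : ℝ) := by
          rw [← Real.rpow_natCast, ← Real.rpow_mul (by norm_num)]; norm_num
      _ ≤ ((1.5 : ℝ) ^ (2 : ℕ)) ^ (1 / 5 : ℝ) := by gcongr; norm_num
      _ = (1.5 : ℝ) ^ (0.4 : ℝ) := by
          rw [← Real.rpow_natCast, ← Real.rpow_mul (by norm_num)]; norm_num
  rcases N with _ | N
  · norm_num
  rw [Finset.sum_range_succ']
  have h := key N
  have hpos : 0 ≤ ((N : ℝ) + 1.5) ^ (-(0.4 : ℝ)) := by positivity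
  have e : ∀ j : ℕ, (((j + 1 : ℕ) : ℝ) + 1) = (j : ℝ) + 2 := fun j => by push_cast; ring
  simp only [e, Nat.cast_zero, zero_add, Real.one_rpow]
  linarith

theorem log_log_two_ge : -0.367 ≤ Real.log (Real.log 2) := by
  rw [Real.le_log_iff_exp_le (Real.log_pos (by norm_num))]
  refine le_trans ?_ Real.log_two_gt_d9.le
  rw [Real.exp_neg, inv_le_comm₀ (Real.exp_pos _) (by norm_num)]
  refine le_trans ?_ (Real.sum_le_exp_of_nonneg (by norm_num) 5)
  norm_num [Finset.sum_range_succ, Nat.factorial]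

theorem log_52_ge : 1.648 ≤ Real.log 5.2 := by
  rw [Real.le_log_iff_exp_le (by norm_num)]
  have h : Real.exp 1.648 = Real.exp 1 * Real.exp 0.648 := by rw [← Real.exp_add]; norm_num
  rw [h]
  have h2 := Real.exp_bound' (x := 0.648) (by norm_num) (by norm_num) (n := 8) (by norm_num)
  norm_num [Finset.sum_range_succ, Nat.factorial] at h2
  have := Real.exp_one_lt_d9
  norm_num
  nlinarith [Real.exp_pos (81/125)]

theorem log_314_le : Real.log 3.14 ≤ 1.145 := by
  rw [Real.log_le_iff_le_exp (by norm_num)]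
  refine le_trans ?_ (Real.sum_le_exp_of_nonneg (by norm_num) 10)
  norm_num [Finset.sum_range_succ, Nat.factorial]

/-- The exponent `-log α_j` of the error probability `α_j = α / 3.14 * (j + 1) ^ (-1.4)` of the
epoch starting at `2 ^ j` is covered by the bracket of the boundary, up to the factor `1.4`. -/
theorem stitching_exponent_le {M α : ℝ} (hM : 1 ≤ M) (hα : 0 < α) (hα1 : α ≤ 1) {j k : ℕ}
    (hjk : 2 ^ j ≤ k) :
    1.4 * Real.log (j + 1) + Real.log (3.14 / α)
      ≤ 1.4 * (Real.log (Real.log (2 * k * M)) + 0.72 * Real.log (5.2 / α)) := by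
  have hl2 := Real.log_pos (x := 2) (by norm_num)
  have h1 : ((j : ℝ) + 1) * Real.log 2 ≤ Real.log (2 * k * M) := by
    have : ((j : ℝ) + 1) * Real.log 2 = Real.log (2 ^ (j + 1)) := by
      rw [Real.log_pow]; push_cast; ring
    rw [this]
    apply Real.log_le_log (by positivity)
    have hk : (2 : ℝ) ^ j ≤ k := by exact_mod_cast hjk
    have : (0 : ℝ) < 2 ^ j := by positivity
    rw [pow_succ]
    nlinarith
  have h2 := Real.log_le_log (by positivity) h1
  rw [Real.log_mul (by positivity) hl2.ne'] at h2
  have hα2 : Real.log α ≤ 0 := Real.log_nonpos hα.le hα1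
  rw [Real.log_div (by norm_num) hα.ne', Real.log_div (by norm_num) hα.ne']
  have := log_log_two_ge
  have := log_52_ge
  have := log_314_le
  norm_num at *
  linarith

/-! ### Ville's inequality for sub-Gaussian sums -/

section Ville
variable {Ω : Type*} [MeasurableSpace Ω] {P : Measure Ω}

theorem integrable_prod_range [IsFiniteMeasure P] {W : ℕ → Ω → ℝ} (hmeas : ∀ k, Measurable (W k))
    (hindep : iIndepFun W P) (hint : ∀ k, Integrable (W k) P) (k : ℕ) :
    Integrable (∏ i ∈ Finset.range k, W i) P := by
  induction k with
  | zero => exact integrable_const (μ := P) (1 : ℝ)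
  | succ k ih =>
    rw [Finset.prod_range_succ]
    exact (hindep.indepFun_finsetProd_of_notMem hmeas Finset.notMem_range_self).integrable_mul ih
      (hint k)

theorem martingale_prod_range {W : ℕ → Ω → ℝ} (hmeas : ∀ k, Measurable (W k))
    (hindep : iIndepFun W P) (hint : ∀ k, Integrable (W k) P) (hone : ∀ k, ∫ ω, W k ω ∂P = 1) :
    Martingale (fun k => ∏ i ∈ Finset.range (k + 1), W i)
      (Filtration.natural W fun k => (hmeas k).stronglyMeasurable) P := by
  have := hindep.isProbabilityMeasure
  have hadp : StronglyAdapted (Filtration.natural W fun k => (hmeas k).stronglyMeasurable)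
      (fun k => ∏ i ∈ Finset.range (k + 1), W i) := by
    intro k
    refine Finset.stronglyMeasurable_prod _ fun i hi => ?_
    exact (Filtration.stronglyAdapted_natural fun k => (hmeas k).stronglyMeasurable) i |>.mono
      ((Filtration.natural W _).mono (Finset.mem_range_succ_iff.1 hi))
  refine martingale_nat hadp (fun k => integrable_prod_range hmeas hindep hint (k + 1)) fun k => ?_
  have h1 := hindep.condExp_natural_ae_eq_of_lt (fun k => (hmeas k).stronglyMeasurable)
    k.lt_succ_self
  have h2 := integrable_prod_range hmeas hindep hint (k + 1 + 1)
  rw [Finset.prod_range_succ] at h2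
  have h3 := condExp_mul_of_stronglyMeasurable_left (hadp k) h2 (hint (k + 1))
  filter_upwards [h1, h3] with ω hω1 hω2
  rw [Finset.prod_range_succ _ (k + 1)]
  rw [hω2, Pi.mul_apply, hω1, hone, mul_one]

/-- **Ville's inequality** for products of independent nonnegative variables of mean one. -/
theorem measure_exists_prod_range_ge_le {W : ℕ → Ω → ℝ} (hmeas : ∀ k, Measurable (W k))
    (hindep : iIndepFun W P) (hint : ∀ k, Integrable (W k) P) (hone : ∀ k, ∫ ω, W k ω ∂P = 1)
    (hnonneg : ∀ k, 0 ≤ W k) {r : ℝ} (hr : 0 < r) :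
    P {ω | ∃ k, r ≤ ∏ i ∈ Finset.range (k + 1), W i ω} ≤ ENNReal.ofReal r⁻¹ := by
  have := hindep.isProbabilityMeasure
  have hmart := martingale_prod_range hmeas hindep hint hone
  have hnn : (0 : ℕ → Ω → ℝ) ≤ fun k => ∏ i ∈ Finset.range (k + 1), W i := fun k ω => by
    simpa [Finset.prod_apply] using Finset.prod_nonneg fun i _ => hnonneg i ω
  have hbound : ∀ N, P {ω | ∃ k ≤ N, r ≤ ∏ i ∈ Finset.range (k + 1), W i ω}
      ≤ ENNReal.ofReal r⁻¹ := by
    intro N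
    have h := maximal_ineq hmart.submartingale hnn (ε := r.toNNReal) N
    have hle : ENNReal.ofReal (∫ ω in {ω | ((r.toNNReal : NNReal) : ℝ) ≤
        (Finset.range (N + 1)).sup' Finset.nonempty_range_add_one fun k =>
          (∏ i ∈ Finset.range (k + 1), W i) ω}, (∏ i ∈ Finset.range (N + 1), W i) ω ∂P) ≤ 1 := by
      rw [← ENNReal.ofReal_one]
      apply ENNReal.ofReal_le_ofReal
      calc _ ≤ ∫ ω, (∏ i ∈ Finset.range (N + 1), W i) ω ∂P :=
            setIntegral_le_integral (integrable_prod_range hmeas hindep hint _)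
              (Filter.Eventually.of_forall (hnn N))
        _ = ∫ ω, (∏ i ∈ Finset.range (0 + 1), W i) ω ∂P := by
            have h := hmart.setIntegral_eq (i := 0) (j := N) (Nat.zero_le _) MeasurableSet.univ
            simpa using h.symm
        _ = 1 := by simpa using hone 0
    rw [ENNReal.ofReal_inv_of_pos hr, ENNReal.le_inv_iff_mul_le, mul_comm]
    refine le_trans ?_ (h.trans hle)
    refine mul_le_mul' le_rfl (measure_mono fun ω hω => ?_)
    obtain ⟨k, hk, hkr⟩ := hω
    simp only [Set.mem_ofPred_eq, Finset.le_sup'_iff]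
    exact ⟨k, by simpa [Nat.lt_succ_iff] using hk, by simpa [hr.le, Finset.prod_apply] using hkr⟩
  have hU : {ω | ∃ k, r ≤ ∏ i ∈ Finset.range (k + 1), W i ω}
      = ⋃ N, {ω | ∃ k ≤ N, r ≤ ∏ i ∈ Finset.range (k + 1), W i ω} := by
    ext ω
    simp only [Set.mem_ofPred_eq, Set.mem_iUnion]
    exact ⟨fun ⟨k, hk⟩ => ⟨k, k, le_rfl, hk⟩, fun ⟨_, k, _, hk⟩ => ⟨k, hk⟩⟩
  rw [hU, Monotone.measure_iUnion]
  · exact iSup_le hbound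
  · exact fun N N' hN ω ⟨k, hk, hkr⟩ => ⟨k, hk.trans hN, hkr⟩

/-- Partial sums of independent `c`-sub-Gaussian variables cross the line of intercept `x / l` and
slope `c * l / 2` with probability at most `exp (-x)`, at any time. -/
theorem measure_exists_line_crossing_le {Y : ℕ → Ω → ℝ} {c : NNReal}
    (hindep : iIndepFun Y P) (hsub : ∀ k, HasSubgaussianMGF (Y k) c P) (l x : ℝ) :
    P {ω | ∃ k : ℕ, x + (k + 1) * (c * l ^ 2 / 2) ≤ l * ∑ i ∈ Finset.range (k + 1), Y i ω}
      ≤ ENNReal.ofReal (Real.exp (-x)) := by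
  have := hindep.isProbabilityMeasure
  -- the natural filtration needs measurable variables, not just a.e. measurable ones
  wlog hmeas : ∀ k, Measurable (Y k) generalizing Y
  · have hae : ∀ k, Y k =ᵐ[P] (hsub k).aemeasurable.mk := fun k => (hsub k).aemeasurable.ae_eq_mk
    have h := this (hindep.congr hae) (fun k => (hsub k).congr (hae k))
      fun k => (hsub k).aemeasurable.measurable_mk
    refine le_trans (measure_mono_ae ?_) h
    filter_upwards [ae_all_iff.2 hae] with ω hω ⟨k, hk⟩
    refine ⟨k, ?_⟩
    simpa only [hω] using hk
  have hpos : ∀ k, 0 < mgf (Y k) P l := fun k => mgf_pos ((hsub k).integrable_exp_mul l)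
  -- normalizing by the exact `mgf` makes the product a martingale, as Doob's inequality requires;
  -- `exp (l * Y - c * l ^ 2 / 2)` would only give a supermartingale
  set W : ℕ → Ω → ℝ := fun k ω => Real.exp (l * Y k ω) / mgf (Y k) P l with hW
  have h := measure_exists_prod_range_ge_le (P := P) (W := W)
    (fun k => ((measurable_const.mul (hmeas k)).exp).div_const _)
    (hindep.comp (fun k y => Real.exp (l * y) / mgf (Y k) P l) fun k => by fun_prop)
    (fun k => ((hsub k).integrable_exp_mul l).div_const _)
    (fun k => by
      rw [hW]; simp only [integral_div]; exact div_self (hpos k).ne')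
    (fun k ω => div_nonneg (Real.exp_pos _).le (hpos k).le) (Real.exp_pos x)
  rw [← Real.exp_neg] at h
  refine le_trans (measure_mono ?_) h
  rintro ω ⟨k, hk⟩
  refine ⟨k, ?_⟩
  rw [hW]
  simp only [Finset.prod_div_distrib]
  rw [le_div_iff₀ (Finset.prod_pos fun i _ => hpos i), ← Real.exp_sum, ← Finset.mul_sum]
  calc Real.exp x * ∏ i ∈ Finset.range (k + 1), mgf (Y i) P l
      ≤ Real.exp x * ∏ i ∈ Finset.range (k + 1), Real.exp (c * l ^ 2 / 2) := by
        gcongr with i _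
        · exact fun i _ => (hpos i).le
        · exact (hsub i).mgf_le l
    _ = Real.exp (x + (k + 1) * (c * l ^ 2 / 2)) := by
        rw [Finset.prod_const, Finset.card_range, ← Real.exp_nat_mul, ← Real.exp_add]
        push_cast; rfl
    _ ≤ _ := Real.exp_le_exp.2 hk

end Ville

/-! ### The stitched boundary and the confidence intervals -/

section Stitching
variable {Ω : Type*} [MeasurableSpace Ω] {P : Measure Ω}

/-- Over one epoch the line tuned to `n = q` stays below the boundary. At `n = q` it touches the
curve `√(2 * x * n)` (with `s = 1`), and a distance of a factor `√2` from `q` on either side costs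
the factor `(2 + √2 + 1 / √2) / 4` in the square. -/
theorem line_le_boundary {x q n L s : ℝ} (hx : 0 < x) (hq : 0 < q) (hs : 0 < s)
    (hn : q / √2 ≤ n) (hn' : n ≤ q * √2) (hL : x ≤ 1.4 * L) :
    x + n * (s ^ 2 * (√(2 * x / q) / s) ^ 2 / 2)
      ≤ √(2 * x / q) / s * (n * (1.7 * √(s ^ 2 * L / n))) := by
  have h2 : (0 : ℝ) < √2 := by positivity
  have hn0 : 0 < n := lt_of_lt_of_le (by positivity) hn
  have hL0 : 0 < L := by linarith
  have e1 : s ^ 2 * (√(2 * x / q) / s) ^ 2 = 2 * x / q := by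
    rw [div_pow, Real.sq_sqrt (by positivity)]; field_simp
  rw [e1]
  refine (pow_le_pow_iff_left₀ (by positivity) (by positivity) two_ne_zero).1 ?_
  have e2 : (√(2 * x / q) / s * (n * (1.7 * √(s ^ 2 * L / n)))) ^ 2
      = 2.89 * (2 * x * n * L / q) := by
    rw [mul_pow, mul_pow, mul_pow, div_pow, Real.sq_sqrt (by positivity),
      Real.sq_sqrt (by positivity)]
    field_simp
    norm_num
  rw [e2]
  have e3 : (x + n * (2 * x / q / 2)) ^ 2 = x ^ 2 / q ^ 2 * (q + n) ^ 2 := by field_simp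
  -- `n / q` lies between `1 / √2` and `√2`
  have hquad : (q + n) ^ 2 ≤ (2 + 3 / 2 * √2) * (q * n) := by
    have hn2 : q ≤ n * √2 := by rwa [div_le_iff₀ h2] at hn
    have hs2 : √2 * √2 = 2 := Real.mul_self_sqrt (by norm_num)
    have h := mul_nonneg (sub_nonneg.2 hn2) (sub_nonneg.2 hn')
    have h3 : (n * √2 - q) * (q * √2 - n) * √2 = 3 * √2 * (q * n) - 2 * (n ^ 2 + q ^ 2) := by
      linear_combination (√2 * n * q - n ^ 2 - q ^ 2) * hs2
    have := mul_nonneg h h2.le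
    nlinarith
  have hsq2 : √2 ≤ 1.4143 := by rw [Real.sqrt_le_left (by norm_num)]; norm_num
  rw [e3]
  calc x ^ 2 / q ^ 2 * (q + n) ^ 2 ≤ x ^ 2 / q ^ 2 * (2.89 * (2 / 1.4) * (q * n)) := by
        gcongr
        refine hquad.trans ?_
        gcongr
        norm_num at hsq2 ⊢
        linarith
    _ = 2.89 * (2 * x * n * (x / 1.4) / q) := by field_simp
    _ ≤ 2.89 * (2 * x * n * L / q) := by
        gcongr
        rw [div_le_iff₀ (by norm_num)]; linarith

theorem tsum_stitching_weights_le {α : ℝ} (hα : 0 < α) :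
    ∑' j : ℕ, ENNReal.ofReal (Real.exp (-(1.4 * Real.log (j + 1) + Real.log (3.14 / α))))
      ≤ ENNReal.ofReal α := by
  refine ENNReal.tsum_le_of_sum_range_le fun N => ?_
  rw [← ENNReal.ofReal_sum_of_nonneg fun _ _ => (Real.exp_pos _).le]
  apply ENNReal.ofReal_le_ofReal
  have e : ∀ j : ℕ, Real.exp (-(1.4 * Real.log (j + 1) + Real.log (3.14 / α)))
      = α / 3.14 * ((j : ℝ) + 1) ^ (-(1.4 : ℝ)) := by
    intro j
    rw [neg_add, Real.exp_add, Real.exp_neg (Real.log _), Real.exp_log (by positivity),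
      Real.rpow_def_of_pos (by positivity), inv_div, mul_comm]
    congr 2; ring
  simp only [e, ← Finset.mul_sum]
  calc α / 3.14 * ∑ j ∈ Finset.range N, ((j : ℝ) + 1) ^ (-(1.4 : ℝ)) ≤ α / 3.14 * 3.14 := by
        gcongr; exact sum_rpow_le N
    _ = α := by field_simp

/-- One-sided time-uniform validity of the stitched boundary. The index `k` stands for `k + 1`
observations. -/
theorem measure_exists_boundary_crossing_le {Y : ℕ → Ω → ℝ} {σ : NNReal} (hσ : 0 < σ)
    (hindep : iIndepFun Y P) (hsub : ∀ k, HasSubgaussianMGF (Y k) (σ ^ 2) P)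
    {α : ℝ} (hα : 0 < α) (hα1 : α ≤ 1) :
    P {ω | ∃ k : ℕ, (k + 1) * stitchedRadius σ (k + 1) α < ∑ i ∈ Finset.range (k + 1), Y i ω}
      ≤ ENNReal.ofReal α := by
  have hσ' : (0 : ℝ) < σ := hσ
  set x : ℕ → ℝ := fun j => 1.4 * Real.log (j + 1) + Real.log (3.14 / α) with hx
  set l : ℕ → ℝ := fun j => √(2 * x j / (√2 * 2 ^ j)) / σ with hl
  have hxpos : ∀ j, 0 < x j := fun j => by
    have h1 : 0 ≤ Real.log ((j : ℝ) + 1) := Real.log_nonneg (by linarith [j.cast_nonneg (α := ℝ)])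
    have h2 : 0 < Real.log (3.14 / α) := Real.log_pos (by rw [lt_div_iff₀ hα]; linarith)
    positivity
  calc _ ≤ P (⋃ j, {ω | ∃ k : ℕ, x j + (k + 1) * ((σ ^ 2 : NNReal) * l j ^ 2 / 2)
            ≤ l j * ∑ i ∈ Finset.range (k + 1), Y i ω}) := by
        refine measure_mono ?_
        rintro ω ⟨k, hk⟩
        -- `j` is the epoch of `k + 1`
        set j := Nat.log 2 (k + 1) with hj
        have hjk : 2 ^ j ≤ k + 1 := Nat.pow_log_le_self 2 k.succ_ne_zero
        have hjk' : k + 1 ≤ 2 ^ (j + 1) := (Nat.lt_pow_succ_log_self (by norm_num) _).le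
        refine Set.mem_iUnion.2 ⟨j, k, ?_⟩
        have hs2 : √2 * √2 = 2 := Real.mul_self_sqrt (by norm_num)
        have h := line_le_boundary (n := (k : ℝ) + 1) (hxpos j)
          (q := √2 * 2 ^ j) (by positivity) hσ'
          (by rw [mul_div_cancel_left₀ _ (by positivity)]; exact_mod_cast hjk)
          (by rw [mul_right_comm, hs2, ← pow_succ']; exact_mod_cast hjk')
          (stitching_exponent_le (le_max_right ((σ : ℝ) ^ 2) 1) hα hα1 hjk)
        have hl0 : 0 ≤ l j := by positivity
        push_cast
        refine (h.trans ?_).trans (mul_le_mul_of_nonneg_left hk.le hl0)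
        simp only [stitchedRadius]
        push_cast
        rfl
    _ ≤ ∑' j, ENNReal.ofReal (Real.exp (-(x j))) :=
        (measure_iUnion_le _).trans (ENNReal.tsum_le_tsum fun j =>
          measure_exists_line_crossing_le hindep hsub (l j) (x j))
    _ ≤ _ := tsum_stitching_weights_le hα

theorem measure_confidence_failure_le {n : ℕ} {S : Fin n → Measure ℝ} {μ : Fin n → ℝ}
    {σ : NNReal} (hσ : 0 < σ)
    (hsub : ∀ i, HasSubgaussianMGF (fun y => y - μ i) (σ ^ 2) (S i))
    {δ : ℝ} (hδ : 0 < δ) (hδ1 : δ < 1) {X : Fin n → ℕ → Ω → ℝ}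
    (hlaw : ∀ i k, HasLaw (X i k) (S i) P)
    (hindep : iIndepFun (fun p : Fin n × ℕ => X p.1 p.2) P) :
    P {ω | ¬ ∀ i k, |(∑ j ∈ Finset.range (k + 1), X i j ω) / (k + 1 : ℕ) - μ i|
        ≤ stitchedRadius σ (k + 1) (δ / (2 * n))} ≤ ENNReal.ofReal δ := by
  -- without arms the level `δ / (2 * n)` is a division by zero, but nothing can fail
  rcases n.eq_zero_or_pos with rfl | hn
  · simp
  have hn1 : (1 : ℝ) ≤ n := by exact_mod_cast hn
  have hα : 0 < δ / (2 * n) := by positivity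
  have hα1 : δ / (2 * n) ≤ 1 := by rw [div_le_one (by positivity)]; linarith
  have hsubX : ∀ i k, HasSubgaussianMGF (fun ω => X i k ω - μ i) (σ ^ 2) P := fun i k =>
    HasSubgaussianMGF.of_map (X := fun y => y - μ i) (hlaw i k).aemeasurable
      ((hlaw i k).map_eq ▸ hsub i)
  have hindX : ∀ i, iIndepFun (fun k ω => X i k ω - μ i) P := fun i =>
    (hindep.precomp (g := fun k : ℕ => (i, k)) fun a b h => (Prod.ext_iff.1 h).2).comp
      (fun _ y => y - μ i) fun _ => by fun_prop
  have hup : ∀ i, P {ω | ∃ k : ℕ, (k + 1) * stitchedRadius σ (k + 1) (δ / (2 * n))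
      < ∑ j ∈ Finset.range (k + 1), (X i j ω - μ i)} ≤ ENNReal.ofReal (δ / (2 * n)) := fun i =>
    measure_exists_boundary_crossing_le hσ (hindX i) (hsubX i) hα hα1
  have hlow : ∀ i, P {ω | ∃ k : ℕ, (k + 1) * stitchedRadius σ (k + 1) (δ / (2 * n))
      < ∑ j ∈ Finset.range (k + 1), -(X i j ω - μ i)} ≤ ENNReal.ofReal (δ / (2 * n)) := fun i =>
    measure_exists_boundary_crossing_le hσ
      ((hindX i).comp (fun _ y => -y) fun _ => measurable_neg) (fun k => (hsubX i k).neg) hα hα1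
  calc _ ≤ P (⋃ i, ({ω | ∃ k : ℕ, (k + 1) * stitchedRadius σ (k + 1) (δ / (2 * n))
            < ∑ j ∈ Finset.range (k + 1), (X i j ω - μ i)} ∪
          {ω | ∃ k : ℕ, (k + 1) * stitchedRadius σ (k + 1) (δ / (2 * n))
            < ∑ j ∈ Finset.range (k + 1), -(X i j ω - μ i)})) := by
        refine measure_mono fun ω hω => ?_
        simp only [Set.mem_ofPred_eq, not_forall, not_le] at hω
        obtain ⟨i, k, hk⟩ := hω
        refine Set.mem_iUnion.2 ⟨i, ?_⟩
        have hk0 : (0 : ℝ) < k + 1 := by positivity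
        have e : (∑ j ∈ Finset.range (k + 1), X i j ω) / (k + 1 : ℕ) - μ i
            = (∑ j ∈ Finset.range (k + 1), (X i j ω - μ i)) / (k + 1) := by
          rw [Finset.sum_sub_distrib, Finset.sum_const, Finset.card_range, nsmul_eq_mul]
          push_cast
          field_simp
        rw [e, lt_abs] at hk
        refine hk.imp (fun h => ⟨k, ?_⟩) fun h => ⟨k, ?_⟩
        · rwa [lt_div_iff₀ hk0, mul_comm] at h
        · rw [Finset.sum_neg_distrib]
          rwa [← neg_div, lt_div_iff₀ hk0, mul_comm] at h
    _ ≤ ∑ i : Fin n, (ENNReal.ofReal (δ / (2 * n)) + ENNReal.ofReal (δ / (2 * n))) :=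
        (measure_iUnion_fintype_le _ _).trans (Finset.sum_le_sum fun i _ =>
          (measure_union_le _ _).trans (add_le_add (hup i) (hlow i)))
    _ = ENNReal.ofReal δ := by
        rw [← ENNReal.ofReal_add hα.le hα.le,
          ← ENNReal.ofReal_sum_of_nonneg fun _ _ => by positivity]
        congr 1
        rw [Finset.sum_const, Finset.card_univ, Fintype.card_fin, nsmul_eq_mul]
        field_simp
        ring

end Stitching

/-! ### Inverting the iterated logarithm -/

theorem one_le_log_exp_one_add {y : ℝ} (hy : 0 ≤ y) : 1 ≤ Real.log (Real.exp 1 + y) := by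
  rw [Real.le_log_iff_exp_le (by positivity)]; linarith

theorem log_log_exp_one_add_mono {y z : ℝ} (hy : 0 ≤ y) (hyz : y ≤ z) :
    Real.log (Real.log (Real.exp 1 + y)) ≤ Real.log (Real.log (Real.exp 1 + z)) :=
  Real.log_le_log (by linarith [one_le_log_exp_one_add hy])
    (Real.log_le_log (by positivity) (by linarith))

/-- Inversion of `N ≤ c * g * (log log (2 * N * M) + b)`. Bounding `log log` by a square root gives
a polynomial bound on `N`; its iterated logarithm is then fed back into the hypothesis. -/
theorem le_of_le_mul_log_log {N M g ℓ : ℝ} (hN : 1 ≤ N) (hM : 1 ≤ M) (hg : 0 ≤ g)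
    (hℓ : Real.log 2 ≤ ℓ)
    (h : N ≤ 11.56 * g * (Real.log (Real.log (2 * N * M)) + 0.72 * (Real.log 5.2 + ℓ))) :
    N ≤ 1110 * g * (ℓ + Real.log (Real.log (Real.exp 1 + M * g))) := by
  have hg0 : 0 < g := by
    rcases hg.eq_or_lt with rfl | h0
    · norm_num at h; linarith
    · exact h0
  have hℓ1 : 0.69 ≤ ℓ := by linarith [Real.log_two_gt_d9]
  have hG : 0 < M * g := by positivity
  set w := Real.log (Real.exp 1 + M * g) with hw
  have hw1 : 1 ≤ w := one_le_log_exp_one_add hG.le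
  have hv : 0 ≤ Real.log w := Real.log_nonneg hw1
  have h52 : Real.log 5.2 ≤ 4.2 := (Real.log_le_sub_one_of_pos (by norm_num)).trans (by norm_num)
  have hb : 0.72 * (Real.log 5.2 + ℓ) ≤ 6 * ℓ := by norm_num at *; linarith
  have hz : 1 ≤ N * M := one_le_mul_of_one_le_of_one_le hN hM
  rw [mul_assoc 2 N M] at h
  set z := N * M with hzdef
  have hr1 : 1 ≤ √(2 * z) := by rw [Real.one_le_sqrt]; linarith
  have hr2 : √(2 * z) * √(2 * z) = 2 * z := Real.mul_self_sqrt (by linarith)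
  set r := √(2 * z) with hr
  have hy : Real.log (2 * z) = 2 * Real.log r := by
    rw [← hr2, Real.log_mul (by linarith) (by linarith)]; ring
  have hy0 : 0 < Real.log (2 * z) := Real.log_pos (by linarith)
  set y := Real.log (2 * z) with hydef
  have hlogy : Real.log y ≤ 2 * r := by
    have h1 := Real.log_le_sub_one_of_pos hy0
    have h2 := Real.log_le_sub_one_of_pos (x := r) (by linarith)
    linarith
  -- a first, polynomial bound on `N`
  have hr3 : r ≤ 23.12 * (M * g) * (2 + 6 * ℓ) := by
    have h1 : N ≤ 11.56 * g * ((2 + 6 * ℓ) * r) := by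
      refine h.trans ?_
      gcongr
      nlinarith
    have h2 : r * r ≤ 23.12 * (M * g) * (2 + 6 * ℓ) * r := by
      rw [hr2, hzdef]
      have := mul_le_mul_of_nonneg_left h1 (by linarith : (0 : ℝ) ≤ 2 * M)
      norm_num at this ⊢
      linarith
    exact le_of_mul_le_mul_right h2 (by linarith)
  -- taking logarithms twice
  have hlogr : Real.log r ≤ 22.12 + w + (1 + 6 * ℓ) := by
    refine (Real.log_le_log (by linarith) hr3).trans ?_
    rw [Real.log_mul (by positivity) (by linarith), Real.log_mul (by norm_num) hG.ne']
    have h1 := Real.log_le_sub_one_of_pos (x := 23.12) (by norm_num)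
    have h2 := Real.log_le_log hG (by linarith [Real.exp_pos 1] : M * g ≤ Real.exp 1 + M * g)
    have h3 := Real.log_le_sub_one_of_pos (x := 2 + 6 * ℓ) (by linarith)
    norm_num at h1 ⊢
    linarith
  have hyw : y ≤ w * (50 + 12 * ℓ) := by rw [hy]; norm_num at *; nlinarith
  have hloglog : Real.log y ≤ Real.log w + 90 * ℓ := by
    refine (Real.log_le_log hy0 hyw).trans ?_
    rw [Real.log_mul (by linarith) (by linarith)]
    have := Real.log_le_sub_one_of_pos (x := 50 + 12 * ℓ) (by linarith)
    norm_num at *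
    linarith
  calc N ≤ 11.56 * g * (96 * (ℓ + Real.log w)) := by
        refine h.trans ?_
        gcongr
        linarith
    _ ≤ 1110 * g * (ℓ + Real.log w) := by
        have : 0 ≤ g * (ℓ + Real.log w) := by positivity
        norm_num
        linarith

/-! ### Pathwise analysis of a run -/

section Deterministic

variable {n m : ℕ} {A : Matrix (Fin m) (Fin n) ℝ} {σ δ ε : ℝ} {x : Fin n → ℕ → ℝ}
  {B C : ℕ → Fin m} {I J : ℕ → Fin n} {μ : Fin n → ℝ}

/-- The outcomes `x` are covered: after any number `k + 1` of observations of any source arm `i`,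
the empirical mean is within the stitched radius of `μ i`. This does not involve the choices of the
algorithm, so its probability can be bounded arm by arm. -/
def IsCovered (σ δ : ℝ) (x : Fin n → ℕ → ℝ) (μ : Fin n → ℝ) : Prop :=
  ∀ i k, |(∑ j ∈ Finset.range (k + 1), x i j) / (k + 1 : ℕ) - μ i|
    ≤ stitchedRadius σ (k + 1) (δ / (2 * n))

theorem pulls_pos (i : Fin n) (t : ℕ) : 0 < pulls I J i t := Nat.lt_add_right _ one_pos

theorem pulls_succ (i : Fin n) (t : ℕ) : pulls I J i (t + 1)
    = pulls I J i t + ((if I t = i then 1 else 0) + (if J t = i then 1 else 0)) := by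
  rw [pulls, pulls, Finset.sum_range_succ, add_assoc]

theorem IsCovered.abs_empMean_sub_le (h : IsCovered σ δ x μ) (I J : ℕ → Fin n) (i : Fin n)
    (t : ℕ) : |empMean x I J i t - μ i| ≤ radius σ δ I J i t := by
  obtain ⟨k, hk⟩ := Nat.exists_eq_succ_of_ne_zero (pulls_pos (I := I) (J := J) i t).ne'
  rw [empMean, radius, hk]
  exact h i k

theorem IsCovered.mem_srcCI (h : IsCovered σ δ x μ) (I J : ℕ → Fin n) (i : Fin n) (t : ℕ) :
    μ i ∈ srcCI σ δ x I J i t := by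
  induction t with
  | zero =>
    have := abs_le.1 (h.abs_empMean_sub_le I J i 0)
    exact ⟨by rw [srcLCB]; linarith, by rw [srcUCB]; linarith⟩
  | succ t ih =>
    have := abs_le.1 (h.abs_empMean_sub_le I J i (t + 1))
    exact ⟨max_le ih.1 (by linarith), le_min ih.2 (by linarith)⟩

theorem srcUCB_sub_srcLCB_le (i : Fin n) (t : ℕ) :
    srcUCB σ δ x I J i t - srcLCB σ δ x I J i t ≤ 2 * radius σ δ I J i t := by
  have h1 : srcUCB σ δ x I J i t ≤ empMean x I J i t + radius σ δ I J i t := by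
    cases t
    exacts [le_rfl, min_le_right _ _]
  have h2 : empMean x I J i t - radius σ δ I J i t ≤ srcLCB σ δ x I J i t := by
    cases t
    exacts [le_rfl, le_max_right _ _]
  linarith

theorem termMin_le {v : ℝ} {i : Fin n} {t : ℕ} (hv : v ∈ srcCI σ δ x I J i t) (a : Fin m) :
    termMin A σ δ x I J a i t ≤ A a i * v :=
  csInf_le (isCompact_Icc.image (continuous_const_mul _)).bddBelow (Set.mem_image_of_mem _ hv)

theorem le_termMax {v : ℝ} {i : Fin n} {t : ℕ} (hv : v ∈ srcCI σ δ x I J i t) (a : Fin m) :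
    A a i * v ≤ termMax A σ δ x I J a i t :=
  le_csSup (isCompact_Icc.image (continuous_const_mul _)).bddAbove (Set.mem_image_of_mem _ hv)

theorem uncertainty_le {i : Fin n} {t : ℕ} (hne : (srcCI σ δ x I J i t).Nonempty) (a : Fin m) :
    uncertainty A σ δ x I J i a t ≤ |A a i| * (2 * radius σ δ I J i t) := by
  have key : ∀ v ∈ srcCI σ δ x I J i t, ∀ w ∈ srcCI σ δ x I J i t,
      A a i * v - A a i * w ≤ |A a i| * (2 * radius σ δ I J i t) := by
    intro v hv w hw
    calc A a i * v - A a i * w ≤ |A a i * (v - w)| := by rw [mul_sub]; exact le_abs_self _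
      _ = |A a i| * |v - w| := abs_mul _ _
      _ ≤ _ := by
        refine mul_le_mul_of_nonneg_left ?_ (abs_nonneg _)
        have := srcUCB_sub_srcLCB_le (σ := σ) (δ := δ) (x := x) (I := I) (J := J) i t
        exact abs_le.2 ⟨by linarith [hv.1, hw.2], by linarith [hv.2, hw.1]⟩
  rw [uncertainty, sub_le_iff_le_add']
  refine csSup_le (hne.image _) ?_
  rintro _ ⟨v, hv, rfl⟩
  rw [← sub_le_iff_le_add]
  refine le_csInf (hne.image _) ?_
  rintro _ ⟨w, hw, rfl⟩
  linarith [key v hv w hw]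

theorem IsCovered.tgtLCB_le (h : IsCovered σ δ x μ) (I J : ℕ → Fin n) (a : Fin m) (t : ℕ) :
    tgtLCB A σ δ x I J a t ≤ (A *ᵥ μ) a :=
  Finset.sum_le_sum fun i _ => termMin_le (h.mem_srcCI I J i t) a

theorem IsCovered.le_tgtUCB (h : IsCovered σ δ x μ) (I J : ℕ → Fin n) (a : Fin m) (t : ℕ) :
    (A *ᵥ μ) a ≤ tgtUCB A σ δ x I J a t :=
  Finset.sum_le_sum (s := Finset.univ) (f := fun i => A a i * μ i) fun i _ =>
    le_termMax (h.mem_srcCI I J i t) a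

theorem tgtUCB_sub_tgtLCB_eq (a : Fin m) (t : ℕ) :
    tgtUCB A σ δ x I J a t - tgtLCB A σ δ x I J a t = ∑ i, uncertainty A σ δ x I J i a t :=
  (Finset.sum_sub_distrib _ _).symm

/-- The source arm `i` that contributes most to the interval of `a` accounts for at least the
fraction `1 / sparsity A a` of its length, and its contribution is at most `2 * |A a i|` times its
radius. -/
theorem sum_uncertainty_le (h : IsCovered σ δ x μ) {a : Fin m} {i : Fin n} {t : ℕ}
    (hi : ∀ j, uncertainty A σ δ x I J j a t ≤ uncertainty A σ δ x I J i a t) :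
    tgtUCB A σ δ x I J a t - tgtLCB A σ δ x I J a t
      ≤ sparsity A a * (|A a i| * (2 * radius σ δ I J i t)) := by
  classical
  have hcard : sparsity A a = (Finset.univ.filter fun j => A a j ≠ 0).card := by
    rw [sparsity, Set.ncard_eq_toFinset_card']
    congr 1
    ext j
    simp
  rw [tgtUCB_sub_tgtLCB_eq, hcard, ← nsmul_eq_mul, ← Finset.sum_const, Finset.sum_filter]
  refine Finset.sum_le_sum fun j _ => ?_
  split_ifs with hj
  · exact (hi j).trans (uncertainty_le ⟨_, h.mem_srcCI I J i t⟩ a)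
  · rw [not_not] at hj
    simpa [hj] using uncertainty_le (A := A) ⟨_, h.mem_srcCI I J j t⟩ a

variable {a₁ a₂ : Fin m} {ν : Fin m → ℝ}

/-- In a round without a stop, one of the two compared target arms has an interval at least as long
as its gap. Otherwise the interval of `C t`, which is longer than `ε`, misses the midpoint `ν̄`. If
it is below `ν̄`, then `B t` is the best arm and its interval contains `ν a₁` and reaches below
`ν̄ - ε`; if it is above, then so is that of `B t`, and two arms would have means above `ν̄`. -/
theorem exists_gap_le_width (hrun : IsRun A σ δ x B C I J) (h : IsCovered σ δ x μ)
    (hν : ν = A *ᵥ μ) (h₂ : ∀ a, a ≠ a₁ → ν a ≤ ν a₂) (h₁ : ∀ a, ν a ≤ ν a₁)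
    (hε : 0 ≤ ε) {t : ℕ} (hcont : ¬ Stops A σ δ ε x B C I J t) :
    ∃ a, (a = B t ∨ a = C t) ∧ max |(ν a₁ + ν a₂) / 2 - ν a| (ε / 2)
      ≤ tgtUCB A σ δ x I J a t - tgtLCB A σ δ x I J a t := by
  subst hν
  rw [Stops, not_le] at hcont
  have hBmax := hrun.B_max t (C t)
  have hB1 := h.tgtLCB_le (A := A) I J (B t) t
  have hB2 := h.le_tgtUCB (A := A) I J (B t) t
  have hC1 := h.tgtLCB_le (A := A) I J (C t) t
  have hC2 := h.le_tgtUCB (A := A) I J (C t) t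
  have h12 := h₁ a₂
  set ν := A *ᵥ μ
  by_contra! hcon
  have hB := hcon _ (Or.inl rfl)
  have hC := hcon _ (Or.inr rfl)
  have hC' : tgtUCB A σ δ x I J (C t) t - tgtLCB A σ δ x I J (C t) t
      < |(ν a₁ + ν a₂) / 2 - ν (C t)| := by
    rcases lt_max_iff.1 hC with hC | hC
    exacts [hC, by linarith]
  rcases le_or_gt (ν (C t)) ((ν a₁ + ν a₂) / 2) with hle | hgt
  · -- the interval of `C t` lies below the midpoint, so `B t` is the best target arm
    rw [abs_of_nonneg (by linarith)] at hC'
    have hBbest : ν (B t) = ν a₁ := by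
      by_contra hne
      have hne1 : a₁ ≠ B t := fun e => hne (by rw [e])
      have := hrun.C_max t a₁ hne1
      have := h.le_tgtUCB (A := A) I J a₁ t
      have : ν a₁ ≤ tgtUCB A σ δ x I J a₁ t := this
      linarith
    rcases lt_max_iff.1 hB with hB | hB
    · rw [hBbest, abs_of_nonpos (by linarith)] at hB
      linarith
    · linarith
  · -- the interval of `C t` lies above the midpoint, and so does that of `B t`
    rw [abs_of_neg (by linarith)] at hC'
    have hCa : C t = a₁ := by
      by_contra hne
      linarith [h₂ _ hne]
    have hBa : B t = a₁ := by
      by_contra hne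
      linarith [h₂ _ hne]
    exact hrun.C_ne t (hCa.trans hBa.symm)

/-- The `i`-th summand of the complexity `H_ε`. -/
noncomputable def armComplexity (A : Matrix (Fin m) (Fin n) ℝ) (ν : Fin m → ℝ) (νbar ε : ℝ)
    (i : Fin n) : ℝ :=
  ⨆ a, (sparsity A a : ℝ) ^ 2 * |A a i| ^ 2 / max |νbar - ν a| (ε / 2) ^ 2

theorem armComplexity_nonneg (A : Matrix (Fin m) (Fin n) ℝ) (ν : Fin m → ℝ) (νbar ε : ℝ)
    (i : Fin n) : 0 ≤ armComplexity A ν νbar ε i :=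
  Real.iSup_nonneg fun a => by positivity

/-- A source arm that contributes most to an interval longer than its gap has been pulled only
`O(σ² * h i * (log (2 * n / δ) + log log ...))` times, with `h i` its `armComplexity`. -/
theorem pulls_le_of_gap_le_width {σ : NNReal} (hσ : 0 < σ) (h : IsCovered σ δ x μ)
    (hδ : 0 < δ) (hδ1 : δ < 1) {νbar : ℝ}
    {a : Fin m} {i : Fin n} {t : ℕ} (hgap : 0 < max |νbar - ν a| (ε / 2))
    (hwidth : max |νbar - ν a| (ε / 2) ≤ tgtUCB A σ δ x I J a t - tgtLCB A σ δ x I J a t)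
    (hi : ∀ j, uncertainty A σ δ x I J j a t ≤ uncertainty A σ δ x I J i a t) :
    (pulls I J i t : ℝ) ≤ 1110 * ((σ : ℝ) ^ 2 * armComplexity A ν νbar ε i) *
      (Real.log (2 * n / δ) + Real.log (Real.log (Real.exp 1 +
        max ((σ : ℝ) ^ 2) 1 * ((σ : ℝ) ^ 2 * armComplexity A ν νbar ε i)))) := by
  have hσ' : (0 : ℝ) < σ := hσ
  have hn : 0 < n := i.pos
  have hn1 : (1 : ℝ) ≤ n := by exact_mod_cast hn
  have hN : (1 : ℝ) ≤ pulls I J i t := by exact_mod_cast pulls_pos i t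
  have hh := armComplexity_nonneg A ν νbar ε i
  refine le_of_le_mul_log_log hN (le_max_right _ _) (by positivity)
    (Real.log_le_log (by norm_num) ?_) ?_
  · rw [le_div_iff₀ hδ]; nlinarith
  set Δ := max |νbar - ν a| (ε / 2)
  set N : ℝ := (pulls I J i t : ℝ)
  have h1 := hwidth.trans (sum_uncertainty_le h hi)
  have hle : (sparsity A a : ℝ) ^ 2 * |A a i| ^ 2 / Δ ^ 2 ≤ armComplexity A ν νbar ε i :=
    le_ciSup (f := fun a => (sparsity A a : ℝ) ^ 2 * |A a i| ^ 2 / max |νbar - ν a| (ε / 2) ^ 2)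
      (Set.finite_range _).bddAbove a
  -- the radius is the square root of a quantity that might be negative (then it is `0`); the
  -- positive gap rules this out
  have hrad : 0 < radius σ δ I J i t := by
    by_contra hneg
    have : (sparsity A a : ℝ) * (|A a i| * (2 * radius σ δ I J i t)) ≤ 0 := by
      have : |A a i| * (2 * radius σ δ I J i t) ≤ 0 :=
        mul_nonpos_of_nonneg_of_nonpos (abs_nonneg _) (by linarith)
      exact mul_nonpos_of_nonneg_of_nonpos (Nat.cast_nonneg _) this
    linarith
  have hlog : Real.log (5.2 / (δ / (2 * n))) = Real.log 5.2 + Real.log (2 * n / δ) := by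
    rw [← Real.log_mul (by norm_num) (by positivity)]
    congr 1; field_simp
  have hsq : radius σ δ I J i t ^ 2 = 2.89 * ((σ : ℝ) ^ 2 * (Real.log (Real.log
      (2 * N * max ((σ : ℝ) ^ 2) 1)) + 0.72 * (Real.log 5.2 + Real.log (2 * n / δ))) / N) := by
    rw [radius, stitchedRadius, hlog] at hrad ⊢
    rw [mul_pow, Real.sq_sqrt (Real.sqrt_pos.1 (pos_of_mul_pos_right hrad (by norm_num))).le]
    norm_num
    rfl
  have h2 : Δ ^ 2 ≤ (sparsity A a * (|A a i| * (2 * radius σ δ I J i t))) ^ 2 :=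
    pow_le_pow_left₀ hgap.le h1 2
  have h3 : 1 ≤ 4 * armComplexity A ν νbar ε i * radius σ δ I J i t ^ 2 := by
    calc (1 : ℝ) ≤ (sparsity A a * (|A a i| * (2 * radius σ δ I J i t))) ^ 2 / Δ ^ 2 := by
          rwa [one_le_div (by positivity)]
      _ = 4 * ((sparsity A a : ℝ) ^ 2 * |A a i| ^ 2 / Δ ^ 2) * radius σ δ I J i t ^ 2 := by ring
      _ ≤ _ := by gcongr
  rw [hsq] at h3
  have hN0 : 0 < N := by linarith
  calc N ≤ N * _ := le_mul_of_one_le_right hN0.le h3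
    _ = _ := by field_simp; norm_num; ring

/-- If the round `s` is charged to a source arm `c s` that it pulls, and that arm has had at most
`T (c s)` pulls before, then there are at most `∑ i, T i` such rounds. The initial pull of every arm
makes up for the charged round itself, so that no additive term `n` appears. -/
theorem le_sum_of_pulls_le {T : Fin n → ℝ} (hT : ∀ i, 0 ≤ T i) {t : ℕ}
    {c : ℕ → Fin n} (hc : ∀ s < t, c s = I s ∨ c s = J s)
    (hpulls : ∀ s < t, pulls I J (c s) s ≤ T (c s)) :
    (t : ℝ) ≤ ∑ i, T i := by
  have key : ∀ i, ∀ s ≤ t, (({r ∈ Finset.range s | c r = i}.card : ℕ) : ℝ) ≤ T i ∧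
      {r ∈ Finset.range s | c r = i}.card + 1 ≤ pulls I J i s := by
    intro i s
    induction s with
    | zero => exact fun _ => ⟨by simpa using hT i, by simp [pulls]⟩
    | succ s ih =>
      intro hs
      obtain ⟨ih1, ih2⟩ := ih (by omega)
      rw [Finset.range_add_one, Finset.filter_insert, pulls_succ]
      split_ifs with hci
      all_goals try (exact ⟨ih1, by omega⟩)
      all_goals
        rw [Finset.card_insert_of_notMem (by simp)]
      all_goals first
        | (have h1 := hpulls s (by omega)
           rw [hci] at h1
           refine ⟨le_trans ?_ h1, by omega⟩
           exact_mod_cast ih2)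
        | (rcases hc s (by omega) with h | h <;> simp_all)
  calc (t : ℝ) = ∑ i, (({r ∈ Finset.range t | c r = i}.card : ℕ) : ℝ) := by
        rw [← Nat.cast_sum, ← Finset.card_eq_sum_card_fiberwise (fun _ _ => Finset.mem_univ _),
          Finset.card_range]
    _ ≤ _ := Finset.sum_le_sum fun i _ => (key i t le_rfl).1

theorem stoppingTime_eq_succ {t : ℕ} (ht : Stops A σ δ ε x B C I J t)
    (hlt : ∀ s < t, ¬ Stops A σ δ ε x B C I J s) :
    stoppingTime A σ δ ε x B C I J = (t + 1 : ℕ) := by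
  refine le_antisymm (iInf₂_le t ht) (le_iInf₂ fun s hs => ?_)
  have : t ≤ s := by
    by_contra! hst
    exact hlt s hst hs
  exact_mod_cast Nat.succ_le_succ this

/-- The sample complexity bound on every covered run. -/
theorem exists_stoppingTime_le {σ : NNReal} (hσ : 0 < σ) (hrun : IsRun A σ δ x B C I J)
    (h : IsCovered σ δ x μ) (hδ : 0 < δ) (hδ1 : δ < 1) (hν : ν = A *ᵥ μ) (h₁ : ∀ a, ν a ≤ ν a₁)
    (h₂ : ∀ a, a ≠ a₁ → ν a ≤ ν a₂) (hε : 0 ≤ ε) (hgap : ε = 0 → ν a₂ < ν a₁) :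
    ∃ τ : ℕ, stoppingTime A σ δ ε x B C I J = τ ∧
      (τ : ℝ) ≤ 1 + 1110 * (σ : ℝ) ^ 2 * complexity A ν ((ν a₁ + ν a₂) / 2) ε *
        (Real.log (2 * n / δ) + Real.log (Real.log (Real.exp 1 +
          max ((σ : ℝ) ^ 2) 1 * (σ : ℝ) ^ 2 * complexity A ν ((ν a₁ + ν a₂) / 2) ε))) := by
  have hn : 0 < n := (I 0).pos
  have hn1 : (1 : ℝ) ≤ n := by exact_mod_cast hn
  set νbar := (ν a₁ + ν a₂) / 2 with hbar
  set f := armComplexity A ν νbar ε with hf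
  have hf0 : ∀ i, 0 ≤ f i := armComplexity_nonneg A ν νbar ε
  have hH : complexity A ν νbar ε = ∑ i, f i := rfl
  set H := complexity A ν νbar ε
  have hℓ : 0 ≤ Real.log (2 * n / δ) := Real.log_nonneg (by rw [le_div_iff₀ hδ]; linarith)
  have hgap' : ∀ a, 0 < max |νbar - ν a| (ε / 2) := by
    intro a
    rcases hε.eq_or_lt with h0 | h0
    · refine lt_max_of_lt_left (abs_pos.2 fun h0' => ?_)
      have := hgap h0.symm
      by_cases ha : a = a₁
      · rw [ha] at h0'; linarith
      · linarith [h₂ a ha]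
    · exact lt_max_of_lt_right (by linarith)
  set T : Fin n → ℝ := fun i => 1110 * ((σ : ℝ) ^ 2 * f i) *
      (Real.log (2 * n / δ) + Real.log (Real.log (Real.exp 1 +
        max ((σ : ℝ) ^ 2) 1 * ((σ : ℝ) ^ 2 * f i)))) with hT
  have hloglog : ∀ {y : ℝ}, 0 ≤ y → 0 ≤ Real.log (Real.log (Real.exp 1 + y)) := fun hy =>
    Real.log_nonneg (one_le_log_exp_one_add hy)
  have hT0 : ∀ i, 0 ≤ T i := fun i => by
    have := hf0 i
    have := hloglog (y := max ((σ : ℝ) ^ 2) 1 * ((σ : ℝ) ^ 2 * f i)) (by positivity)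
    positivity
  have hbound : ∀ t, (∀ s < t, ¬ Stops A σ δ ε x B C I J s) → (t : ℝ) ≤ ∑ i, T i := by
    intro t ht
    have hex : ∀ s, ∃ i, s < t → (i = I s ∨ i = J s) ∧ (pulls I J i s : ℝ) ≤ T i := by
      intro s
      by_cases hs : s < t
      · obtain ⟨a, ha | ha, hw⟩ := exists_gap_le_width hrun h hν h₂ h₁ hε (ht s hs)
        · exact ⟨I s, fun _ => ⟨Or.inl rfl, pulls_le_of_gap_le_width hσ h hδ hδ1 (hgap' a) hw
            fun j => ha ▸ hrun.I_max s j⟩⟩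
        · exact ⟨J s, fun _ => ⟨Or.inr rfl, pulls_le_of_gap_le_width hσ h hδ hδ1 (hgap' a) hw
            fun j => ha ▸ hrun.J_max s j⟩⟩
      · exact ⟨I s, fun h => absurd h hs⟩
    choose c hc using hex
    exact le_sum_of_pulls_le hT0 (fun s hs => (hc s hs).1) fun s hs => (hc s hs).2
  have hexists : ∃ t, Stops A σ δ ε x B C I J t := by
    by_contra! hno
    obtain ⟨t, ht⟩ := exists_nat_gt (∑ i, T i)
    exact absurd (hbound t fun s _ => hno s) (not_le.2 ht)
  classical
  refine ⟨Nat.find hexists + 1, stoppingTime_eq_succ (Nat.find_spec hexists)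
    fun s hs => Nat.find_min hexists hs, ?_⟩
  have hsum : ∑ i, T i ≤ 1110 * (σ : ℝ) ^ 2 * H * (Real.log (2 * n / δ) +
      Real.log (Real.log (Real.exp 1 + max ((σ : ℝ) ^ 2) 1 * (σ : ℝ) ^ 2 * H))) := by
    calc ∑ i, T i ≤ ∑ i, 1110 * ((σ : ℝ) ^ 2 * f i) * (Real.log (2 * n / δ) +
          Real.log (Real.log (Real.exp 1 + max ((σ : ℝ) ^ 2) 1 * (σ : ℝ) ^ 2 * H))) := by
          refine Finset.sum_le_sum fun i _ => ?_
          have := hf0 i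
          refine mul_le_mul_of_nonneg_left (add_le_add_right
            (log_log_exp_one_add_mono (by positivity) ?_) _) (by positivity)
          rw [mul_assoc]
          gcongr
          rw [hH]
          exact Finset.single_le_sum (fun i _ => hf0 i) (Finset.mem_univ i)
      _ = _ := by rw [← Finset.sum_mul, ← Finset.mul_sum, ← Finset.mul_sum, hH]; ring
  have := hbound _ fun s hs => Nat.find_min hexists hs
  push_cast
  linarith

end Deterministic

end TLUCB

theorem corollary2 :
    ∃ K : ℝ, 0 < K ∧
      ∀ (n m : ℕ) (A : Matrix (Fin m) (Fin n) ℝ)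
        -- source arms: distributions with means `μ i`, sub-Gaussian with parameter `σ`
        (S : Fin n → Measure ℝ) [∀ i, IsProbabilityMeasure (S i)]
        (μ : Fin n → ℝ) (_ : ∀ i, μ i = ∫ y, y ∂(S i))
        (σ : NNReal) (_ : 0 < σ)
        (_ : ∀ i, HasSubgaussianMGF (fun y => y - μ i) (σ ^ 2) (S i))
        -- target means, a best target arm and a best one among the others
        (ν : Fin m → ℝ) (_ : ν = A *ᵥ μ)
        (a₁ a₂ : Fin m) (_ : a₂ ≠ a₁) (_ : ∀ a, ν a ≤ ν a₁) (_ : ∀ a, a ≠ a₁ → ν a ≤ ν a₂)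
        (ε δ : ℝ) (_ : 0 ≤ ε) (_ : ε = 0 → ν a₂ < ν a₁) (_ : 0 < δ) (_ : δ < 1)
        -- independent observations, `X i k` being the result of the `(k+1)`-st pull of arm `i`
        (Ω : Type*) [MeasurableSpace Ω] (P : Measure Ω) [IsProbabilityMeasure P]
        (X : Fin n → ℕ → Ω → ℝ) (_ : ∀ i k, HasLaw (X i k) (S i) P)
        (_ : iIndepFun (fun p : Fin n × ℕ => X p.1 p.2) P)
        -- the choices made by the algorithm
        (B C : ℕ → Ω → Fin m) (I J : ℕ → Ω → Fin n)
        (_ : ∀ ω, TLUCB.IsRun A σ δ (fun i k => X i k ω)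
          (fun t => B t ω) (fun t => C t ω) (fun t => I t ω) (fun t => J t ω))
        (H : ℝ) (_ : H = TLUCB.complexity A ν ((ν a₁ + ν a₂) / 2) ε),
        ENNReal.ofReal (1 - δ) ≤ P {ω | ∃ τ : ℕ,
          TLUCB.stoppingTime A σ δ ε (fun i k => X i k ω)
            (fun t => B t ω) (fun t => C t ω) (fun t => I t ω) (fun t => J t ω) = τ ∧
          (τ : ℝ) ≤ 1 + K * (σ : ℝ) ^ 2 * H * (Real.log (2 * n / δ) +
            Real.log (Real.log (Real.exp 1 + max ((σ : ℝ) ^ 2) 1 * (σ : ℝ) ^ 2 * H)))} := by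
  refine ⟨1110, by norm_num, ?_⟩
  intro n m A S _ μ _ σ hσ hsub ν hν a₁ a₂ _ h₁ h₂ ε δ hε hgap hδ hδ1 Ω _ P _ X hlaw hindep
    B C I J hrun H hH
  have hbad := TLUCB.measure_confidence_failure_le hσ hsub hδ hδ1 hlaw hindep
  -- the event need not be measurable: only monotonicity and subadditivity of `P` are used
  rw [ENNReal.ofReal_sub _ hδ.le, ENNReal.ofReal_one, tsub_le_iff_right, ← measure_univ (μ := P)]
  refine le_trans ?_ ((measure_union_le _ _).trans (add_le_add le_rfl hbad))
  refine measure_mono fun ω _ => ?_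
  by_cases hω : TLUCB.IsCovered σ δ (fun i k => X i k ω) μ
  · left
    rw [Set.mem_ofPred_eq, hH]
    exact TLUCB.exists_stoppingTime_le hσ (hrun ω) hω hδ hδ1 hν h₁ h₂ hε hgap
  · exact Or.inr hω
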